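/- Let $G$ be a real Lie group of dimension $2n$ with Lie algebra $\mathfrak g$, let $\{E_1,\dots,E_{2n}\}$ be a basis of $\mathfrak g$, and let $X_1,\dots,X_{2n}$ be the left invariant vector fields on $G$ induced by it. Define tensor fields $J$ and $g$ on $G$, of types $(1,1)$ and $(0,2)$, by $$JX_i=X_{n+i},\qquad JX_{n+i}=-X_i,\qquad g(X_i,X_i)=-g(X_{n+i},X_{n+i})=1\quad(1\le i\le n),\qquad g(X_j,X_k)=0\quad(j\ne k).$$ Suppose that $g$ is a Killing (invariant) metric, i.e. $$g([X,Y],Z)=-g(Y,[X,Z])\qquad\text{for all }X,Y,Z\in\mathfrak g .$$ Then $g$ has a Levi-Civita connection $\nabla$ (the torsion-free connection with $Xg(Y,Z)=g(\nabla_XY,Z)+g(Y,\nabla_XZ)$), and the following hold. (i) $(G,J,g)$ is a quasi-Kähler manifold with Norden metric (a $\mathcal W_3$-manifold). That is, $J$ is a smooth almost complex structure ($J^2=-\mathrm{id}$), $g$ is a smooth pseudo-Riemannian metric with $g(JX,JY)=-g(X,Y)$, and the tensor $F(X,Y,Z)=g\big((\nabla_XJ)Y,Z\big)$, where $(\nabla_XJ)Y=\nabla_X(JY)-J(\nabla_XY)$,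 satisfies $$F(X,Y,Z)+F(Y,Z,X)+F(Z,X,Y)=0$$ for all smooth vector fields $X,Y,Z$ on $G$. (ii) $(G,g)$ is locally symmetric. That is, $\nabla R=0$ for the curvature tensor $R(X,Y,Z,U)=g(R(X,Y)Z,U)$ with $R(X,Y)Z=\nabla_X\nabla_YZ-\nabla_Y\nabla_XZ-\nabla_{[X,Y]}Z$; explicitly, $$V\,R(X,Y,Z,U)-R(\nabla_VX,Y,Z,U)-R(X,\nabla_VY,Z,U)-R(X,Y,\nabla_VZ,U)-R(X,Y,Z,\nabla_VU)=0$$ for all smooth vector fields $V,X,Y,Z,U$ on $G$. -/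

import Mathlib

open scoped Manifold ContDiff

noncomputable section

namespace Norden

section Manifold

variable {E : Type*} [NormedAddCommGroup E] [NormedSpace ℝ E]
  {H : Type*} [TopologicalSpace H] (I : ModelWithCorners ℝ E H)
  {M : Type*} [TopologicalSpace M] [ChartedSpace H M]

/-- Vector fields on `M`, without any regularity. -/
abbrev Field (M : Type*) [TopologicalSpace M] [ChartedSpace H M] : Type _ :=
  (x : M) → TangentSpace I x

/-- A field of endomorphisms of the tangent spaces, i.e. a (1,1)-tensor. -/
abbrev EndField (M : Type*) [TopologicalSpace M] [ChartedSpace H M] : Type _ :=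
  (x : M) → (TangentSpace I x →L[ℝ] TangentSpace I x)

/-- A field of bilinear forms on the tangent spaces, i.e. a (0,2)-tensor. -/
abbrev BilinField (M : Type*) [TopologicalSpace M] [ChartedSpace H M] : Type _ :=
  (x : M) → (TangentSpace I x →L[ℝ] TangentSpace I x →L[ℝ] ℝ)

variable {I} [IsManifold I ∞ M]

/-- `X` is a smooth vector field on `M`. -/
def SmoothField (X : Field I M) : Prop :=
  ContMDiff I I.tangent ∞ (fun x ↦ (⟨x, X x⟩ : TangentBundle I M))

/-- The vector field `J X`. -/
def applyEnd (J : EndField I M) (X : Field I M) : Field I M := fun x ↦ J x (X x)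

/-- The function `g(X, Y)`. -/
def pairing (g : BilinField I M) (X Y : Field I M) : M → ℝ := fun x ↦ g x (X x) (Y x)

/-- `(M, J, g)` is an almost complex manifold with Norden metric: `J` is a smooth (1,1)-tensor
with `J² = -1`, `g` is a smooth pseudo-Riemannian metric, and `g(JX, JY) = -g(X, Y)`. Smoothness
of the tensors is expressed on smooth vector fields. -/
structure IsAlmostComplexNorden (J : EndField I M) (g : BilinField I M) :
    Prop where
  smooth_J : ∀ X : Field I M, SmoothField X → SmoothField (applyEnd J X)
  smooth_g : ∀ X Y : Field I M, SmoothField X → SmoothField Y →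
    ContMDiff I 𝓘(ℝ, ℝ) ∞ (pairing g X Y)
  symm : ∀ (x : M) (u v : TangentSpace I x), g x u v = g x v u
  nondegenerate : ∀ (x : M) (u : TangentSpace I x), (∀ v : TangentSpace I x, g x u v = 0) → u = 0
  J_sq : ∀ (x : M) (u : TangentSpace I x), J x (J x u) = -u
  anti : ∀ (x : M) (u v : TangentSpace I x), g x (J x u) (J x v) = -g x u v

/-- The vector field `∇_X Y`. -/
def nabla (D : CovariantDerivative I E (TangentSpace I : M → Type _)) (X Y : Field I M) :
    Field I M := fun x ↦ D Y x (X x)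

/-- The derivative `X f` of a function along a vector field. -/
def derivAlong (X : Field I M) (f : M → ℝ) : M → ℝ :=
  fun x ↦ (mfderiv I 𝓘(ℝ, ℝ) f x : TangentSpace I x →L[ℝ] ℝ) (X x)

/-- `D` is a Levi-Civita connection of `g`: torsion-free, with
`X g(Y, Z) = g(∇_X Y, Z) + g(Y, ∇_X Z)`. -/
structure IsLeviCivita [FiniteDimensional ℝ E] (g : BilinField I M)
    (D : CovariantDerivative I E (TangentSpace I : M → Type _)) : Prop where
  torsion_free : D.torsion = 0
  metric : ∀ X Y Z : Field I M, SmoothField X → SmoothField Y → SmoothField Z →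
    derivAlong X (pairing g Y Z) = pairing g (nabla D X Y) Z + pairing g Y (nabla D X Z)

/-- `F(X, Y, Z) = g((∇_X J) Y, Z)`, where `(∇_X J) Y = ∇_X (J Y) - J (∇_X Y)`. -/
def tensorF (J : EndField I M) (g : BilinField I M)
    (D : CovariantDerivative I E (TangentSpace I : M → Type _)) (X Y Z : Field I M) : M → ℝ :=
  pairing g (nabla D X (applyEnd J Y) - applyEnd J (nabla D X Y)) Z

/-- `R(X, Y) Z = ∇_X ∇_Y Z - ∇_Y ∇_X Z - ∇_{[X, Y]} Z`. -/
def curvature (D : CovariantDerivative I E (TangentSpace I : M → Type _)) (X Y Z : Field I M) :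
    Field I M :=
  nabla D X (nabla D Y Z) - nabla D Y (nabla D X Z) - nabla D (VectorField.mlieBracket I X Y) Z

/-- `R(X, Y, Z, U) = g(R(X, Y) Z, U)`. -/
def curvature04 (g : BilinField I M) (D : CovariantDerivative I E (TangentSpace I : M → Type _))
    (X Y Z U : Field I M) : M → ℝ :=
  pairing g (curvature D X Y Z) U

/-- The covariant derivative `(∇_V R)(X, Y, Z, U)` of the (0,4)-curvature tensor. -/
def nablaCurvature04 (g : BilinField I M)
    (D : CovariantDerivative I E (TangentSpace I : M → Type _)) (V X Y Z U : Field I M) : M → ℝ :=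
  derivAlong V (curvature04 g D X Y Z U)
    - curvature04 g D (nabla D V X) Y Z U - curvature04 g D X (nabla D V Y) Z U
    - curvature04 g D X Y (nabla D V Z) U - curvature04 g D X Y Z (nabla D V U)

/-- `(M, J, g)`, with Levi-Civita connection `D`, is a quasi-Kähler manifold with Norden metric
(a `W₃`-manifold): the cyclic sum of `F` vanishes. -/
structure IsW3 (J : EndField I M) (g : BilinField I M)
    (D : CovariantDerivative I E (TangentSpace I : M → Type _)) : Prop where
  norden : IsAlmostComplexNorden J g
  cyclic : ∀ X Y Z : Field I M, SmoothField X → SmoothField Y → SmoothField Z →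
    tensorF J g D X Y Z + tensorF J g D Y Z X + tensorF J g D Z X Y = 0

/-- `(M, g)`, with Levi-Civita connection `D`, is locally symmetric: `∇R = 0`. -/
def IsLocallySymmetric (g : BilinField I M)
    (D : CovariantDerivative I E (TangentSpace I : M → Type _)) : Prop :=
  ∀ V X Y Z U : Field I M, SmoothField V → SmoothField X → SmoothField Y → SmoothField Z →
    SmoothField U → nablaCurvature04 g D V X Y Z U = 0

end Manifold

section LieGroup

variable {E : Type*} [NormedAddCommGroup E] [NormedSpace ℝ E]
  {H : Type*} [TopologicalSpace H] {I : ModelWithCorners ℝ E H}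
  {G : Type*} [TopologicalSpace G] [ChartedSpace H G] [Group G]

/-- `(G, J, g)` is the almost Norden manifold determined by the basis `b` of the Lie algebra of
`G`, whose elements `b (inl i)`, `b (inr i)` (`i < n`) stand for `E_i`, `E_{n+i}`. With
`X k = mulInvariantVectorField (b k)` the induced left invariant frame, `J X_i = X_{n+i}`,
`J X_{n+i} = -X_i`, `g(X_i, X_i) = 1 = -g(X_{n+i}, X_{n+i})`, and different fields of the frame
are orthogonal. These equations hold at every point, so `J` and `g` are left invariant. -/
structure IsAlmostNordenOfBasis {n : ℕ} (b : Module.Basis (Fin n ⊕ Fin n) ℝ (GroupLieAlgebra I G))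
    (J : EndField I G) (g : BilinField I G) : Prop where
  J_inl : ∀ (i : Fin n) (x : G), J x (mulInvariantVectorField (b (Sum.inl i)) x) =
    mulInvariantVectorField (b (Sum.inr i)) x
  J_inr : ∀ (i : Fin n) (x : G), J x (mulInvariantVectorField (b (Sum.inr i)) x) =
    -mulInvariantVectorField (b (Sum.inl i)) x
  g_inl : ∀ (i : Fin n) (x : G), g x (mulInvariantVectorField (b (Sum.inl i)) x)
    (mulInvariantVectorField (b (Sum.inl i)) x) = 1
  g_inr : ∀ (i : Fin n) (x : G), g x (mulInvariantVectorField (b (Sum.inr i)) x)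
    (mulInvariantVectorField (b (Sum.inr i)) x) = -1
  g_ne : ∀ (j k : Fin n ⊕ Fin n), j ≠ k → ∀ x : G,
    g x (mulInvariantVectorField (b j) x) (mulInvariantVectorField (b k) x) = 0

/-- The left invariant metric `g` is a Killing (invariant) metric:
`g(ad X (Y), Z) = -g(Y, ad X (Z))` for all `X, Y, Z` in the Lie algebra of `G`. -/
def IsKillingMetric (g : BilinField I G) : Prop :=
  ∀ u v w : GroupLieAlgebra I G, g 1 ⁅u, v⁆ w = -g 1 v ⁅u, w⁆

end LieGroup

end Norden

end

/-!
Left translations trivialize the tangent bundle of a Lie group `G`: a vector field `X` becomes the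
function `leftForm X : G → 𝔤`, its value under the Maurer-Cartan form. In this trivialization the
left invariant tensors `g` and `J` are a constant bilinear form `η` and a constant endomorphism
`j` of the Lie algebra `𝔤`. Write `∂` for the flat connection whose parallel fields are the left
invariant ones (`flatConnection`). Its torsion is `-⁅·, ·⁆` (`flatConnection_torsion`), so

* `[X, Y] = ∂_X Y - ∂_Y X + ⁅X, Y⁆` (`leftForm_mlieBracket`), and
* `∂_X ∂_Y - ∂_Y ∂_X = ∂_{[X, Y]}` (`vecDeriv_vecDeriv_sub`).

The second identity rests on `X (Y f) - Y (X f) = [X, Y] f`, obtained by comparing the Jacobi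
identities of `X, Y, f Z` and of `X, Y, Z` (`derivAlong_mlieBracket_smul`).

The connection `∇_X Y = ∂_X Y + ½ ⁅X, Y⁆` (`halfBracketConnection`) is torsion-free, and it is
metric because `ad` is skew for `η`. Conversely, on left invariant fields a Levi-Civita connection
is determined by its torsion and by the skewness of `g(∇_u v, w)` in `v, w`, so it agrees with this
one on smooth fields (`IsLeviCivita.eq_halfBracketConnection`). No smoothness of the connection is
needed: the difference of two covariant derivatives is a tensor.

What remains is algebra in `𝔤`. Put `φ(u, v, w) = η(⁅u, v⁆, w)`, which is invariant under cyclic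
permutations. The tensor `F(X, Y, Z) = ½ (φ(X, jY, Z) - φ(X, Y, jZ))` then has vanishing cyclic sum
(`isW3_of_leftInvariant`). The curvature is `R(X, Y) Z = -¼ ⁅⁅X, Y⁆, Z⁆`
(`leftForm_curvature_halfBracketConnection`). By the Jacobi identity `ad` acts on this expression as
a derivation in `X, Y, Z`, and `η` is `ad`-invariant, whence `∇R = 0`
(`IsLeviCivita.isLocallySymmetric`).
-/

open scoped Manifold ContDiff

noncomputable section

namespace Norden

open Bundle VectorField

/-! ### The Maurer-Cartan form and its smoothness -/

section LieGroup

variable {E : Type*} [NormedAddCommGroup E] [NormedSpace ℝ E]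
  {H : Type*} [TopologicalSpace H] {I : ModelWithCorners ℝ E H}
  {G : Type*} [TopologicalSpace G] [ChartedSpace H G] [Group G]

section Translation

variable (I) in
/-- The derivative at `1` of the left translation by `x`, as a map from the Lie algebra to the
tangent space at `x`. Its value at `v` is `mulInvariantVectorField v x`. -/
def leftTranslate (x : G) : GroupLieAlgebra I G →L[ℝ] TangentSpace I x :=
  (mfderiv I I (fun y ↦ x * y) 1 : TangentSpace I (1 : G) →L[ℝ] TangentSpace I (x * 1))

theorem leftTranslate_apply (x : G) (v : GroupLieAlgebra I G) :
    leftTranslate I x v = mulInvariantVectorField v x := rfl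

/-- The Maurer-Cartan form: the derivative at `x` of the left translation by `x⁻¹`, as a map from
the tangent space at `x` to the Lie algebra. -/
def maurerCartan (x : G) : TangentSpace I x →L[ℝ] GroupLieAlgebra I G :=
  (mfderiv I I (fun y ↦ x⁻¹ * y) x : TangentSpace I x →L[ℝ] TangentSpace I (x⁻¹ * x))

/-- The vector field `X`, read as a function with values in the Lie algebra. -/
def leftForm (X : Field I G) (x : G) : GroupLieAlgebra I G := maurerCartan x (X x)

theorem leftForm_sub (X Y : Field I G) (x : G) :
    leftForm (X - Y) x = leftForm X x - leftForm Y x := map_sub _ _ _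

theorem mulInvariantVectorField_one (v : GroupLieAlgebra I G) :
    mulInvariantVectorField v 1 = v := by
  have h : (fun y : G ↦ 1 * y) = id := by ext; simp
  simp only [mulInvariantVectorField]
  rw [h]
  exact congrArg (fun A : E →L[ℝ] E ↦ A v) (mfderiv_id (I := I) (x := (1 : G)))

end Translation

variable [LieGroup I ∞ G]

/-- The regularity at which Mathlib defines the Lie algebra structure on `GroupLieAlgebra I G`. -/
theorem lieGroup_minSmoothness : LieGroup I (minSmoothness ℝ 3) G := by
  rw [minSmoothness_of_isRCLikeNormedField]; infer_instance

variable (I G) in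
/-- The derivative of the multiplication, `((x, u), (y, v)) ↦ (x y, dR_y u + dL_x v)`, is smooth. -/
theorem contMDiff_tangentMap_mul : ContMDiff (I.tangent.prod I.tangent) I.tangent ∞
    (fun p : TangentBundle I G × TangentBundle I G ↦ (⟨p.1.1 * p.2.1,
      mfderiv I I (fun y ↦ y * p.2.1) p.1.1 p.1.2 +
        mfderiv I I (fun y ↦ p.1.1 * y) p.2.1 p.2.2⟩ : TangentBundle I G)) := by
  have S := (ContMDiff.contMDiff_tangentMap (contMDiff_mul I (G := G) ∞) (m := ∞) le_rfl).comp
    (contMDiff_equivTangentBundleProd_symm (I := I) (M := G) (I' := I) (M' := G))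
  convert! S with p
  simp only [Function.comp_apply, tangentMap]
  rw [mfderiv_prod_eq_add_apply ((contMDiff_mul I ∞).mdifferentiableAt (by simp))]
  rfl

/-- At regularity `∞`, left invariant vector fields are smooth. -/
theorem smoothField_mulInvariantVectorField (v : GroupLieAlgebra I G) :
    SmoothField (I := I) (mulInvariantVectorField v : Field I G) := by
  -- The field is the derivative of the multiplication applied to `(0_x, v)`.
  have s0 : ContMDiff I I.tangent ∞ (fun x : G ↦ (⟨x, 0⟩ : TangentBundle I G)) :=
    contMDiff_zeroSection _ _
  have sv : ContMDiff I I.tangent ∞ (fun _ : G ↦ (⟨1, v⟩ : TangentBundle I G)) := contMDiff_const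
  have S := (contMDiff_tangentMap_mul I G).comp (s0.prodMk sv)
  unfold SmoothField
  convert! S with x
  · simp
  · have h0 (A : E →L[ℝ] E) (w : E) : w = A 0 + w := by rw [map_zero, zero_add]
    exact h0 _ _

theorem maurerCartan_mulInvariantVectorField (v : GroupLieAlgebra I G) (x : G) :
    maurerCartan x (mulInvariantVectorField v x) = v := by
  have h := mfderiv_comp_apply (I := I) (I' := I) (I'' := I) (1 : G)
    (g := fun y : G ↦ x⁻¹ * y) (f := fun y : G ↦ x * y)
    ((contMDiff_mul_left (I := I) (n := ∞)).mdifferentiableAt (by simp))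
    ((contMDiff_mul_left (I := I) (n := ∞)).mdifferentiableAt (by simp)) v
  have e : ((fun y : G ↦ x⁻¹ * y) ∘ fun y : G ↦ x * y) = id := by ext; simp
  rw [e, mfderiv_id] at h
  -- The chain rule differentiates `x⁻¹ * ·` at `x * 1`, the Maurer-Cartan form at `x`.
  have h1 : ∀ y : G, y = x → (mfderiv I I (fun z : G ↦ x⁻¹ * z) y : E → E)
      ((mfderiv I I (fun z : G ↦ x * z) 1 : E → E) v) = v →
      (mfderiv I I (fun z : G ↦ x⁻¹ * z) x : E → E)
      ((mfderiv I I (fun z : G ↦ x * z) 1 : E → E) v) = v := by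
    rintro y rfl h; exact h
  exact h1 _ (mul_one x) h.symm

theorem mulInvariantVectorField_maurerCartan {x : G} (u : TangentSpace I x) :
    mulInvariantVectorField (maurerCartan x u) x = u := by
  have h := mfderiv_comp_apply (I := I) (I' := I) (I'' := I) x
    (g := fun y : G ↦ x * y) (f := fun y : G ↦ x⁻¹ * y)
    ((contMDiff_mul_left (I := I) (n := ∞)).mdifferentiableAt (by simp))
    ((contMDiff_mul_left (I := I) (n := ∞)).mdifferentiableAt (by simp)) u
  have e : ((fun y : G ↦ x * y) ∘ fun y : G ↦ x⁻¹ * y) = id := by ext; simp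
  rw [e, mfderiv_id] at h
  have h1 : ∀ y : G, y = 1 → (mfderiv I I (fun z : G ↦ x * z) y : E → E)
      ((mfderiv I I (fun z : G ↦ x⁻¹ * z) x : E → E) u) = u →
      (mfderiv I I (fun z : G ↦ x * z) 1 : E → E)
      ((mfderiv I I (fun z : G ↦ x⁻¹ * z) x : E → E) u) = u := by
    rintro y rfl h; exact h
  exact h1 _ (inv_mul_cancel x) h.symm

theorem contMDiff_mk_maurerCartan : ContMDiff I.tangent I.tangent ∞
    (fun p : TangentBundle I G ↦ (⟨1, maurerCartan p.1 p.2⟩ : TangentBundle I G)) := by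
  -- This map is the derivative of the multiplication applied to `(0_{x⁻¹}, p)`, with `p` over `x`.
  have s0 : ContMDiff I.tangent I.tangent ∞
      (fun p : TangentBundle I G ↦ (⟨p.1⁻¹, 0⟩ : TangentBundle I G)) :=
    (contMDiff_zeroSection _ (TangentSpace I : G → Type _)).comp
      ((contMDiff_inv I ∞).comp (contMDiff_proj (TangentSpace I : G → Type _)))
  have S := (contMDiff_tangentMap_mul I G).comp (s0.prodMk contMDiff_id)
  convert! S with p
  · simp
  · have h0 (A : E →L[ℝ] E) (w : E) : w = A 0 + w := by rw [map_zero, zero_add]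
    exact h0 _ _

/-- The components of the Maurer-Cartan form are smooth functions on the tangent bundle. -/
theorem contMDiff_maurerCartan [FiniteDimensional ℝ E] (l : GroupLieAlgebra I G →ₗ[ℝ] ℝ) :
    ContMDiff I.tangent 𝓘(ℝ, ℝ) ∞
      (fun p : TangentBundle I G ↦ l (maurerCartan p.1 p.2)) := by
  intro p
  have h := (contMDiffAt_totalSpace.1 (contMDiff_mk_maurerCartan p)).2
  let l' : E →L[ℝ] ℝ := LinearMap.toContinuousLinearMap (E := E) l
  have h2 := l'.contMDiff.contMDiffAt.comp p h
  refine h2.congr_of_eventuallyEq (Filter.Eventually.of_forall fun q ↦ ?_)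
  -- The trivialization at `1` is the identity on the fibre over `1`.
  change l (maurerCartan q.1 q.2) =
    l (trivializationAt E (TangentSpace I) (1 : G) ⟨1, maurerCartan q.1 q.2⟩).2
  rw [TangentBundle.trivializationAt_apply]
  congr 1
  exact ((tangentBundleCore I G).coordChange_self (achart H (1 : G)) 1
    (mem_chart_source H 1) _).symm

end LieGroup

/-! ### Calculus of functions with values in a finite-dimensional space -/

section Calculus

variable {E : Type*} [NormedAddCommGroup E] [NormedSpace ℝ E]
  {H : Type*} [TopologicalSpace H] {I : ModelWithCorners ℝ E H}
  {M : Type*} [TopologicalSpace M] [ChartedSpace H M]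
  {W W' : Type*} [AddCommGroup W] [Module ℝ W] [AddCommGroup W'] [Module ℝ W']

theorem derivAlong_apply (X : Field I M) (f : M → ℝ) (x : M) :
    derivAlong X f x = mvfderiv I f x (X x) := rfl

variable (I) in
/-- `f : M → W` is differentiable at `x`, expressed by its compositions with linear forms. This
avoids choosing a norm on `W`, such as the Lie algebra of a Lie group. -/
def MDiffVecAt (f : M → W) (x : M) : Prop :=
  ∀ l : W →ₗ[ℝ] ℝ, MDifferentiableAt I 𝓘(ℝ, ℝ) (fun y ↦ l (f y)) x

variable (I) in
/-- `f : M → W` is smooth, expressed by its compositions with linear forms. -/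
def SmoothVec (f : M → W) : Prop :=
  ∀ l : W →ₗ[ℝ] ℝ, ContMDiff I 𝓘(ℝ, ℝ) ∞ (fun y ↦ l (f y))

theorem SmoothVec.mdiffVecAt {f : M → W} (hf : SmoothVec I f) (x : M) : MDiffVecAt I f x :=
  fun l ↦ (hf l).mdifferentiableAt (by simp)

theorem SmoothVec.add {f h : M → W} (hf : SmoothVec I f) (hh : SmoothVec I h) :
    SmoothVec I (fun x ↦ f x + h x) := fun l ↦ by
  simp only [map_add]
  exact (hf l).add (hh l)

theorem SmoothVec.map {f : M → W} (hf : SmoothVec I f) (A : W →ₗ[ℝ] W') :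
    SmoothVec I (fun x ↦ A (f x)) := fun l ↦ hf (l ∘ₗ A)

theorem SmoothVec.smul_const {f : M → W} (hf : SmoothVec I f) (c : ℝ) :
    SmoothVec I (fun x ↦ c • f x) := hf.map (LinearMap.lsmul ℝ W c)

variable {ι : Type*} [Fintype ι] {b : Module.Basis ι ℝ W}

theorem apply_eq_sum (b : Module.Basis ι ℝ W) (l : W →ₗ[ℝ] ℝ) (u : W) :
    l u = ∑ i, l (b i) * b.coord i u := by
  conv_lhs => rw [← b.sum_repr u, map_sum]
  simp [mul_comm]

theorem apply_eq_sum_coord (b : Module.Basis ι ℝ W) (β : W →ₗ[ℝ] W →ₗ[ℝ] W') (u v : W) :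
    β u v = ∑ i, b.coord i u • β (b i) v := by
  conv_lhs => rw [← b.sum_repr u, map_sum]
  simp

theorem SmoothVec.bilin (b : Module.Basis ι ℝ W) (β : W →ₗ[ℝ] W →ₗ[ℝ] W') {f h : M → W}
    (hf : SmoothVec I f) (hh : SmoothVec I h) : SmoothVec I (fun x ↦ β (f x) (h x)) := fun l ↦ by
  have e : (fun y ↦ l (β (f y) (h y))) = fun y ↦ ∑ i, b.coord i (f y) * (l ∘ₗ β (b i)) (h y) := by
    ext y
    rw [apply_eq_sum_coord b]
    simp
  rw [e]
  exact contMDiff_finsetSum fun i _ ↦ (hf _).mul (hh _)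

theorem mvfderiv_finset_sum {ι : Type*} (s : Finset ι) {f : ι → M → ℝ} {x : M}
    (hf : ∀ i, MDifferentiableAt I 𝓘(ℝ, ℝ) (f i) x) :
    MDifferentiableAt I 𝓘(ℝ, ℝ) (fun y ↦ ∑ i ∈ s, f i y) x ∧
    mvfderiv I (fun y ↦ ∑ i ∈ s, f i y) x = ∑ i ∈ s, mvfderiv I (f i) x := by
  classical
  induction s using Finset.induction_on with
  | empty => simpa using ⟨mdifferentiableAt_const, mvfderiv_const (I := I) (0 : ℝ)⟩
  | insert a s ha ih =>
    simp only [Finset.sum_insert ha]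
    exact ⟨(hf a).add ih.1, by rw [mvfderiv_fun_add (hf a) ih.1, ih.2]⟩

/-- The derivative at `x` of `f : M → W`, defined through the coordinates in the basis `b`. For
differentiable `f` it does not depend on `b`, see `map_vecDeriv`. -/
def vecDeriv [TopologicalSpace W] [IsTopologicalAddGroup W] [ContinuousSMul ℝ W]
    (b : Module.Basis ι ℝ W) (f : M → W) (x : M) : TangentSpace I x →L[ℝ] W :=
  ∑ i, (mvfderiv I (fun y ↦ b.coord i (f y)) x).smulRight (b i)

variable [TopologicalSpace W] [IsTopologicalAddGroup W] [ContinuousSMul ℝ W]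

theorem map_vecDeriv {f : M → W} {x : M} (hf : MDiffVecAt I f x) (l : W →ₗ[ℝ] ℝ)
    (v : TangentSpace I x) : l (vecDeriv b f x v) = mvfderiv I (fun y ↦ l (f y)) x v := by
  have e : (fun y ↦ l (f y)) = fun y ↦ ∑ i, l (b i) * b.coord i (f y) := by
    ext y
    exact apply_eq_sum b l (f y)
  rw [e, (mvfderiv_finset_sum (f := fun i y ↦ l (b i) * b.coord i (f y)) _
    fun i ↦ mdifferentiableAt_const.mul (hf (b.coord i))).2]
  have key (i : ι) : mvfderiv I (fun y ↦ l (b i) * b.coord i (f y)) x =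
      l (b i) • mvfderiv I (fun y ↦ b.coord i (f y)) x := by
    rw [mvfderiv_fun_mul mdifferentiableAt_const (hf (b.coord i)), mvfderiv_const]
    simp
  simp_rw [key]
  simp [vecDeriv, mul_comm]

theorem vecDeriv_const (w : W) (x : M) : vecDeriv (I := I) b (fun _ : M ↦ w) x = 0 := by
  simp [vecDeriv, mvfderiv_const]

theorem vecDeriv_add {f h : M → W} {x : M} (hf : MDiffVecAt I f x) (hh : MDiffVecAt I h x) :
    vecDeriv (I := I) b (fun y ↦ f y + h y) x = vecDeriv b f x + vecDeriv b h x := by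
  simp only [vecDeriv, map_add]
  rw [← Finset.sum_add_distrib]
  refine Finset.sum_congr rfl fun i _ ↦ ?_
  rw [mvfderiv_fun_add (hf _) (hh _)]
  ext v
  simp [add_smul]

theorem vecDeriv_smul {a : M → ℝ} {f : M → W} {x : M} (ha : MDifferentiableAt I 𝓘(ℝ, ℝ) a x)
    (hf : MDiffVecAt I f x) :
    vecDeriv (I := I) b (fun y ↦ a y • f y) x =
      a x • vecDeriv b f x + (mvfderiv I a x).smulRight (f x) := by
  ext v
  simp only [vecDeriv, map_smul, smul_eq_mul]
  have key (i : ι) : mvfderiv I (fun y ↦ a y * b.coord i (f y)) x v =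
      a x * mvfderiv I (fun y ↦ b.coord i (f y)) x v + b.coord i (f x) * mvfderiv I a x v := by
    rw [mvfderiv_fun_mul ha (hf _)]
    simp
  simp only [Module.Basis.coord_apply] at key
  conv_rhs => rw [← b.sum_repr (f x)]
  simp only [sum_apply, ContinuousLinearMap.smulRight_apply, key, add_smul,
    Finset.sum_add_distrib, add_apply, smul_apply,
    Finset.smul_sum, smul_smul, Module.Basis.coord_apply]
  congr 1
  exact Finset.sum_congr rfl fun i _ ↦ by rw [mul_comm ((b.repr (f x)) i)]

theorem mvfderiv_bilin (β : W →ₗ[ℝ] W →ₗ[ℝ] ℝ) {f h : M → W} {x : M}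
    (hf : MDiffVecAt I f x) (hh : MDiffVecAt I h x) (v : TangentSpace I x) :
    mvfderiv I (fun y ↦ β (f y) (h y)) x v =
      β (vecDeriv b f x v) (h x) + β (f x) (vecDeriv b h x v) := by
  have e : (fun y ↦ β (f y) (h y)) = fun y ↦ ∑ i, b.coord i (f y) * β (b i) (h y) := by
    ext y
    rw [apply_eq_sum_coord b]
    simp
  rw [e, (mvfderiv_finset_sum (f := fun i y ↦ b.coord i (f y) * β (b i) (h y)) _
    fun i ↦ (hf (b.coord i)).mul (hh (β (b i)))).2,
    apply_eq_sum_coord b _ (vecDeriv b f x v), apply_eq_sum_coord b _ (f x),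
    ← Finset.sum_add_distrib]
  simp only [map_vecDeriv hf, map_vecDeriv hh]
  simp only [sum_apply]
  refine Finset.sum_congr rfl fun i _ ↦ ?_
  rw [mvfderiv_fun_mul (hf (b.coord i)) (hh (β (b i)))]
  simp [mul_comm, add_comm]

theorem vecDeriv_bilin (β : W →ₗ[ℝ] W →ₗ[ℝ] W) {f h : M → W} {x : M}
    (hf : MDiffVecAt I f x) (hh : MDiffVecAt I h x) (v : TangentSpace I x)
    (hβ : MDiffVecAt I (fun y ↦ β (f y) (h y)) x) :
    vecDeriv b (fun y ↦ β (f y) (h y)) x v =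
      β (vecDeriv b f x v) (h x) + β (f x) (vecDeriv b h x v) := by
  refine b.ext_elem fun i ↦ ?_
  change b.coord i _ = b.coord i _
  generalize b.coord i = l
  rw [map_vecDeriv hβ, map_add]
  exact mvfderiv_bilin (β.compr₂ l) hf hh v

theorem vecDeriv_map (A : W →ₗ[ℝ] W) {f : M → W} {x : M} (hf : MDiffVecAt I f x)
    (v : TangentSpace I x) : vecDeriv b (fun y ↦ A (f y)) x v = A (vecDeriv b f x v) := by
  refine b.ext_elem fun i ↦ ?_
  change b.coord i _ = b.coord i _
  generalize b.coord i = l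
  rw [map_vecDeriv (f := fun y ↦ A (f y)) (fun l ↦ hf (l ∘ₗ A))]
  exact (map_vecDeriv (b := b) hf (l ∘ₗ A) v).symm

section Smooth

variable [IsManifold I ∞ M]

theorem SmoothField.contMDiff_derivAlong {X : Field I M} (hX : SmoothField X) {f : M → ℝ}
    (hf : ContMDiff I 𝓘(ℝ, ℝ) ∞ f) : ContMDiff I 𝓘(ℝ, ℝ) ∞ (derivAlong X f) := by
  have h := (contMDiff_snd_tangentBundle_modelSpace ℝ 𝓘(ℝ, ℝ) (n := ∞)).comp
    ((hf.contMDiff_tangentMap (m := ∞) le_rfl).comp hX)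
  exact h

theorem SmoothField.smoothVec_vecDeriv {X : Field I M} (hX : SmoothField X) {f : M → W}
    (hf : SmoothVec I f) : SmoothVec I (fun x ↦ vecDeriv b f x (X x)) := fun l ↦ by
  simp only [map_vecDeriv (hf.mdiffVecAt _)]
  exact hX.contMDiff_derivAlong (hf l)

theorem SmoothField.mdiff {X : Field I M} (hX : SmoothField X) (x : M) :
    MDifferentiableAt I I.tangent (fun x ↦ (⟨x, X x⟩ : TangentBundle I M)) x :=
  ContMDiff.mdifferentiableAt hX (by simp)

theorem SmoothField.smul {X : Field I M} {f : M → ℝ} (hf : ContMDiff I 𝓘(ℝ, ℝ) ∞ f)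
     (hX : SmoothField X) : SmoothField (f • X) := ContMDiff.smul_section hf hX

variable [CompleteSpace E]

theorem SmoothField.mlieBracket {X Y : Field I M} (hX : SmoothField X) (hY : SmoothField Y) :
    SmoothField (mlieBracket I X Y) := fun x ↦
  haveI : IsManifold I (((⊤ : ℕ∞) : ℕ∞ω) + 1) M := ‹IsManifold I ∞ M›
  haveI : IsManifold I (minSmoothness ℝ 2) M := by
    rw [minSmoothness_of_isRCLikeNormedField]; infer_instance
  haveI : IsManifold I (minSmoothness ℝ 3) M := by
    rw [minSmoothness_of_isRCLikeNormedField]; infer_instance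
  ContMDiffAt.mlieBracket_vectorField (n := (⊤ : ℕ∞)) (m := (⊤ : ℕ∞)) (hX x) (hY x)
    (by rw [minSmoothness_of_isRCLikeNormedField]; exact le_rfl)

/-- The commutator formula `X (Y f) - Y (X f) = [X, Y] f`, at the points where some smooth vector
field `Z` does not vanish. It is the coefficient of `Z` when the Jacobi identity for `X, Y, f Z` is
expanded and `f` times the Jacobi identity for `X, Y, Z` is subtracted. -/
theorem derivAlong_mlieBracket_smul {X Y Z : Field I M} (hX : SmoothField X) (hY : SmoothField Y)
    (hZ : SmoothField Z) {f : M → ℝ} (hf : ContMDiff I 𝓘(ℝ, ℝ) ∞ f) (x : M) :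
    (derivAlong X (derivAlong Y f) x - derivAlong Y (derivAlong X f) x
      - derivAlong (VectorField.mlieBracket I X Y) f x) • Z x = 0 := by
  have hb {X Y : Field I M} (hY : SmoothField Y) {f : M → ℝ} (hf : ContMDiff I 𝓘(ℝ, ℝ) ∞ f) :
      VectorField.mlieBracket I X (f • Y) =
        derivAlong X f • Y + f • VectorField.mlieBracket I X Y := by
    ext y
    exact mlieBracket_smul_right (hf.mdifferentiableAt (by simp)) (hY.mdiff y)
  have h2 : minSmoothness ℝ 2 ≤ (∞ : ℕ∞ω) := by
    rw [minSmoothness_of_isRCLikeNormedField]; exact ENat.LEInfty.out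
  have : IsManifold I (minSmoothness ℝ 3) M := by
    rw [minSmoothness_of_isRCLikeNormedField]; infer_instance
  have J1 := leibniz_identity_mlieBracket_apply (I := I) (x := x) ((hX x).of_le h2)
    ((hY x).of_le h2) (((hZ.smul hf) x).of_le h2)
  have J2 := leibniz_identity_mlieBracket_apply (I := I) (x := x) ((hX x).of_le h2)
    ((hY x).of_le h2) ((hZ x).of_le h2)
  have ba {X Y Z : Field I M} (hY : SmoothField Y) (hZ : SmoothField Z) :
      VectorField.mlieBracket I X (Y + Z) x =
        VectorField.mlieBracket I X Y x + VectorField.mlieBracket I X Z x :=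
    mlieBracket_add_right (hY.mdiff x) (hZ.mdiff x)
  have sX := hX.contMDiff_derivAlong hf
  have sY := hY.contMDiff_derivAlong hf
  rw [hb hZ hf, hb hZ hf, hb hZ hf, ba (hZ.smul sY) ((hY.mlieBracket hZ).smul hf),
    ba (hZ.smul sX) ((hX.mlieBracket hZ).smul hf), hb hZ sY, hb hZ sX,
    hb (hY.mlieBracket hZ) hf, hb (hX.mlieBracket hZ) hf] at J1
  simp only [Pi.add_apply, Pi.smul_apply', J2] at J1
  rw [smul_add] at J1
  simp only [sub_smul]
  have := sub_eq_zero.2 J1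
  rw [← this]
  abel

end Smooth

end Calculus

attribute [local instance] lieGroup_minSmoothness

/-! ### Vector fields in the left trivialization and the flat connection -/

section LieGroupFields

variable {E : Type*} [NormedAddCommGroup E] [NormedSpace ℝ E]
  {H : Type*} [TopologicalSpace H] {I : ModelWithCorners ℝ E H}
  {G : Type*} [TopologicalSpace G] [ChartedSpace H G] [Group G] [LieGroup I ∞ G]

theorem maurerCartan_leftTranslate (x : G) (v : GroupLieAlgebra I G) :
    maurerCartan x (leftTranslate I x v) = v := maurerCartan_mulInvariantVectorField v x

theorem leftTranslate_maurerCartan {x : G} (u : TangentSpace I x) :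
    leftTranslate I x (maurerCartan x u) = u := mulInvariantVectorField_maurerCartan u

theorem leftTranslate_leftForm (X : Field I G) (x : G) :
    leftTranslate I x (leftForm X x) = X x := leftTranslate_maurerCartan _

theorem leftForm_mulInvariantVectorField (v : GroupLieAlgebra I G) :
    leftForm (mulInvariantVectorField v : Field I G) = fun _ ↦ v :=
  funext fun x ↦ maurerCartan_mulInvariantVectorField v x

variable {ι : Type*} [Fintype ι] (b : Module.Basis ι ℝ (GroupLieAlgebra I G))

theorem smoothField_of_leftForm (b : Module.Basis ι ℝ (GroupLieAlgebra I G))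
    {X : Field I G} (hX : SmoothVec I (leftForm X)) :
    SmoothField X := by
  have e : X = fun x ↦ ∑ i, b.coord i (leftForm X x) • mulInvariantVectorField (b i) x := by
    ext x
    rw [← leftTranslate_leftForm X x]
    conv_lhs => rw [← b.sum_repr (leftForm X x), map_sum]
    simp [leftTranslate_apply]
  rw [e]
  exact ContMDiff.sum_section fun i _ ↦
    ContMDiff.smul_section (hX (b.coord i)) (smoothField_mulInvariantVectorField (b i))

variable [FiniteDimensional ℝ E]

theorem SmoothField.smoothVec_leftForm {X : Field I G} (hX : SmoothField X) :
    SmoothVec I (leftForm X) := fun l ↦ (contMDiff_maurerCartan l).comp hX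

theorem mdiffVecAt_leftForm {X : Field I G} {x : G}
    (hX : MDifferentiableAt I I.tangent (fun x ↦ (⟨x, X x⟩ : TangentBundle I G)) x) :
    MDiffVecAt I (leftForm X) x := fun l ↦
  ((contMDiff_maurerCartan l).mdifferentiableAt (by simp)).comp x hX

variable (I G) in
/-- The Lie bracket of the Lie algebra of `G`, as a bilinear map. -/
def bracketHom : GroupLieAlgebra I G →ₗ[ℝ] GroupLieAlgebra I G →ₗ[ℝ] GroupLieAlgebra I G :=
  LinearMap.mk₂ ℝ (fun u v ↦ ⁅u, v⁆) add_lie smul_lie lie_add (fun c m n ↦ lie_smul c m n)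

theorem mlieBracket_mulInvariantVectorField (u v : GroupLieAlgebra I G) (x : G) :
    VectorField.mlieBracket I (mulInvariantVectorField u) (mulInvariantVectorField v) x =
      leftTranslate I x ⁅u, v⁆ := by
  rw [← mulInvariantVector_mlieBracket]; rfl

/-- The flat connection for which the left invariant vector fields are parallel: it differentiates
`leftForm Y`. -/
def flatConnection : CovariantDerivative I E (TangentSpace I : G → Type _) where
  toFun Y x := (leftTranslate I x).comp (vecDeriv b (leftForm Y) x)
  isCovariantDerivativeOnUniv :=
    { add := fun {Y Z x} hY hZ _ ↦ by
        have : leftForm (Y + Z) = fun y ↦ leftForm Y y + leftForm Z y := by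
          ext y; simp [leftForm]
        rw [this, vecDeriv_add (mdiffVecAt_leftForm hY) (mdiffVecAt_leftForm hZ)]
        simp
      leibniz := fun {Y a x} hY ha _ ↦ by
        have : leftForm (a • Y) = fun y ↦ a y • leftForm Y y := by
          ext y; simp [leftForm]
        rw [this, vecDeriv_smul ha (mdiffVecAt_leftForm hY)]
        ext v
        simp [leftTranslate_leftForm] }

theorem flatConnection_apply (Y : Field I G) (x : G) (v : TangentSpace I x) :
    flatConnection b Y x v = leftTranslate I x (vecDeriv b (leftForm Y) x v) := rfl

theorem flatConnection_torsion (x : G) (u v : TangentSpace I x) :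
    (flatConnection b).torsion x u v =
      -leftTranslate I x ⁅maurerCartan x u, maurerCartan x v⁆ := by
  have hs (w : GroupLieAlgebra I G) := (smoothField_mulInvariantVectorField w).mdiff x
  have h := (flatConnection b).torsion_apply (hs (maurerCartan x u)) (hs (maurerCartan x v))
  rw [mlieBracket_mulInvariantVectorField, mulInvariantVectorField_maurerCartan,
    mulInvariantVectorField_maurerCartan] at h
  rw [h, flatConnection_apply, flatConnection_apply, leftForm_mulInvariantVectorField,
    leftForm_mulInvariantVectorField, vecDeriv_const, vecDeriv_const]
  simp

theorem leftForm_mlieBracket {X Y : Field I G} (hX : SmoothField X) (hY : SmoothField Y) (x : G) :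
    leftForm (VectorField.mlieBracket I X Y) x = vecDeriv b (leftForm Y) x (X x)
      - vecDeriv b (leftForm X) x (Y x) + ⁅leftForm X x, leftForm Y x⁆ := by
  have h := (flatConnection b).torsion_apply (hX.mdiff x) (hY.mdiff x)
  rw [flatConnection_torsion, flatConnection_apply, flatConnection_apply] at h
  have h' := congrArg (maurerCartan x) h
  simp only [map_neg, map_sub, maurerCartan_leftTranslate] at h'
  change -⁅leftForm X x, leftForm Y x⁆ = _ - _ - leftForm _ x at h'
  rw [eq_sub_iff_add_eq] at h'
  rw [← h']; abel

/-- The connection `flatConnection` is flat. -/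
theorem vecDeriv_vecDeriv_sub {X Y : Field I G} (hX : SmoothField X) (hY : SmoothField Y)
    {f : G → GroupLieAlgebra I G} (hf : SmoothVec I f) (x : G) :
    vecDeriv b (fun y ↦ vecDeriv b f y (Y y)) x (X x)
        - vecDeriv b (fun y ↦ vecDeriv b f y (X y)) x (Y x) =
      vecDeriv b f x (VectorField.mlieBracket I X Y x) := by
  refine b.ext_elem fun i ↦ ?_
  change b.coord i _ = b.coord i _
  rw [map_sub, map_vecDeriv (hf.mdiffVecAt x),
    map_vecDeriv ((hY.smoothVec_vecDeriv hf).mdiffVecAt x),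
    map_vecDeriv ((hX.smoothVec_vecDeriv hf).mdiffVecAt x)]
  simp only [map_vecDeriv (hf.mdiffVecAt _)]
  -- The left invariant field of a basis vector vanishes nowhere.
  have h := derivAlong_mlieBracket_smul hX hY (smoothField_mulInvariantVectorField (b i))
    (hf (b.coord i)) x
  have h' := congrArg (maurerCartan x) h
  rw [map_smul, maurerCartan_mulInvariantVectorField, map_zero, smul_eq_zero_iff_left (b.ne_zero i)]
    at h'
  exact sub_eq_zero.1 h'

end LieGroupFields

/-! ### The Levi-Civita connection -/

section LeviCivita

variable {E : Type*} [NormedAddCommGroup E] [NormedSpace ℝ E]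
  {H : Type*} [TopologicalSpace H] {I : ModelWithCorners ℝ E H}
  {G : Type*} [TopologicalSpace G] [ChartedSpace H G] [Group G]

/-- The metric `g` is left invariant with value `η` on the Lie algebra, where `η` is symmetric,
nondegenerate and `ad`-invariant. -/
structure IsInvariantMetric (g : BilinField I G)
    (η : GroupLieAlgebra I G →ₗ[ℝ] GroupLieAlgebra I G →ₗ[ℝ] ℝ) : Prop where
  apply : ∀ (x : G) (u v : TangentSpace I x), g x u v = η (maurerCartan x u) (maurerCartan x v)
  symm : ∀ u v : GroupLieAlgebra I G, η u v = η v u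
  nondegenerate : ∀ u : GroupLieAlgebra I G, (∀ v : GroupLieAlgebra I G, η u v = 0) → u = 0
  ad : ∀ u v w : GroupLieAlgebra I G, η ⁅u, v⁆ w = -η v ⁅u, w⁆

variable {g : BilinField I G} {η : GroupLieAlgebra I G →ₗ[ℝ] GroupLieAlgebra I G →ₗ[ℝ] ℝ}

theorem IsInvariantMetric.pairing_eq (hg : IsInvariantMetric g η) (X Y : Field I G) :
    pairing g X Y = fun x ↦ η (leftForm X x) (leftForm Y x) := funext fun x ↦ hg.apply x _ _

variable [FiniteDimensional ℝ E] [LieGroup I ∞ G]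

variable {ι : Type*} [Fintype ι] (b : Module.Basis ι ℝ (GroupLieAlgebra I G))

variable (I) in
/-- The bilinear map `½ ⁅u, v⁆` on each tangent space. As in `CovariantDerivative.addOneForm`, the
direction `u` of differentiation is the second argument. -/
def halfBracket (x : G) :
    TangentSpace I x →L[ℝ] TangentSpace I x →L[ℝ] TangentSpace I x :=
  haveI : FiniteDimensional ℝ (TangentSpace I x) := inferInstanceAs (FiniteDimensional ℝ E)
  haveI : T2Space (TangentSpace I x) := inferInstanceAs (T2Space E)
  LinearMap.toContinuousBilinearMap <| LinearMap.mk₂ ℝ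
    (fun v u ↦ (2⁻¹ : ℝ) • leftTranslate I x ⁅maurerCartan x u, maurerCartan x v⁆)
    (by simp) (by intros; simp [smul_comm (2⁻¹ : ℝ)]) (by simp)
    (by intros; simp [smul_comm (2⁻¹ : ℝ)])

/-- The connection `∇_X Y = ∂_X Y + ½ ⁅X, Y⁆`, where `∂` is the flat connection. -/
def halfBracketConnection : CovariantDerivative I E (TangentSpace I : G → Type _) :=
  (flatConnection b).addOneForm (halfBracket I)

theorem halfBracketConnection_apply (Y : Field I G) (x : G) (u : TangentSpace I x) :
    halfBracketConnection b Y x u = leftTranslate I x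
      (vecDeriv b (leftForm Y) x u + (2⁻¹ : ℝ) • ⁅maurerCartan x u, leftForm Y x⁆) := by
  rw [map_add, map_smul]; rfl

theorem leftForm_nabla_halfBracketConnection (X Y : Field I G) :
    leftForm (nabla (halfBracketConnection b) X Y) =
      fun x ↦ vecDeriv b (leftForm Y) x (X x) + (2⁻¹ : ℝ) • ⁅leftForm X x, leftForm Y x⁆ := by
  ext x
  change maurerCartan x (halfBracketConnection b Y x (X x)) = _
  rw [halfBracketConnection_apply, maurerCartan_leftTranslate]; rfl

theorem halfBracketConnection_mulInvariantVectorField (u v : GroupLieAlgebra I G) (x : G) :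
    halfBracketConnection b (mulInvariantVectorField v) x (mulInvariantVectorField u x) =
      (2⁻¹ : ℝ) • leftTranslate I x ⁅u, v⁆ := by
  rw [halfBracketConnection_apply, leftForm_mulInvariantVectorField, vecDeriv_const,
    maurerCartan_mulInvariantVectorField]
  simp

theorem halfBracketConnection_torsion : (halfBracketConnection b).torsion = 0 := by
  ext x u v
  have hs (w : GroupLieAlgebra I G) := (smoothField_mulInvariantVectorField w).mdiff x
  have h := (halfBracketConnection b).torsion_apply (hs (maurerCartan x u)) (hs (maurerCartan x v))
  rw [mlieBracket_mulInvariantVectorField, halfBracketConnection_mulInvariantVectorField,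
    halfBracketConnection_mulInvariantVectorField, mulInvariantVectorField_maurerCartan,
    mulInvariantVectorField_maurerCartan, ← lie_skew (maurerCartan x u), map_neg] at h
  rw [h, Pi.zero_apply]
  change _ = (0 : TangentSpace I x)
  module

theorem IsInvariantMetric.cyclic (hg : IsInvariantMetric g η) (u v w : GroupLieAlgebra I G) :
    η ⁅v, w⁆ u = η ⁅u, v⁆ w := by
  rw [hg.ad, hg.symm, ← lie_skew u v, map_neg, LinearMap.neg_apply]

theorem IsInvariantMetric.derivAlong_pairing (hg : IsInvariantMetric g η) (X : Field I G)
    {Y Z : Field I G} (hY : SmoothField Y) (hZ : SmoothField Z) (x : G) :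
    derivAlong X (pairing g Y Z) x = η (vecDeriv b (leftForm Y) x (X x)) (leftForm Z x)
      + η (leftForm Y x) (vecDeriv b (leftForm Z) x (X x)) := by
  rw [hg.pairing_eq]
  exact mvfderiv_bilin η (hY.smoothVec_leftForm.mdiffVecAt x) (hZ.smoothVec_leftForm.mdiffVecAt x) _

theorem IsInvariantMetric.isLeviCivita (hg : IsInvariantMetric g η) :
    IsLeviCivita g (halfBracketConnection b) where
  torsion_free := halfBracketConnection_torsion b
  metric X Y Z _ hY hZ := by
    ext x
    rw [hg.derivAlong_pairing b X hY hZ, Pi.add_apply, hg.pairing_eq, hg.pairing_eq,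
      leftForm_nabla_halfBracketConnection, leftForm_nabla_halfBracketConnection]
    simp only [map_add, map_smul, LinearMap.add_apply, LinearMap.smul_apply, smul_eq_mul, hg.ad]
    ring

/-- A Levi-Civita connection of a left invariant, `ad`-invariant metric is `½ ⁅u, v⁆` on left
invariant fields. -/
theorem IsLeviCivita.apply_mulInvariantVectorField (hg : IsInvariantMetric g η)
    {D : CovariantDerivative I E (TangentSpace I : G → Type _)} (hD : IsLeviCivita g D)
    (u v : GroupLieAlgebra I G) (x : G) :
    D (mulInvariantVectorField v) x (mulInvariantVectorField u x) =
      (2⁻¹ : ℝ) • leftTranslate I x ⁅u, v⁆ := by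
  set T : GroupLieAlgebra I G → GroupLieAlgebra I G → GroupLieAlgebra I G := fun u v ↦
    maurerCartan x (D (mulInvariantVectorField v) x (mulInvariantVectorField u x)) with hT
  have hs (w : GroupLieAlgebra I G) := smoothField_mulInvariantVectorField w
  have tors (u v) : T u v - T v u = ⁅u, v⁆ := by
    have h := D.torsion_apply ((hs u).mdiff x) ((hs v).mdiff x)
    rw [hD.torsion_free, mlieBracket_mulInvariantVectorField] at h
    have h' := congrArg (maurerCartan x) h
    simp only [map_sub, maurerCartan_leftTranslate] at h'
    exact sub_eq_zero.1 (h'.symm.trans (map_zero _))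
  have comp (u v w) : η (T u v) w + η v (T u w) = 0 := by
    have h := congrFun (hD.metric _ _ _ (hs u) (hs v) (hs w)) x
    rw [Pi.add_apply, hg.pairing_eq, hg.pairing_eq, hg.pairing_eq,
      leftForm_mulInvariantVectorField, leftForm_mulInvariantVectorField] at h
    rw [derivAlong_apply, mvfderiv_const] at h
    exact h.symm
  -- Both `η(T u v, w)` and `½ η(⁅u, v⁆, w)` are skew in `v, w`, and they have the same
  -- antisymmetrization in `u, v`. The cyclic sum of these relations gives equality.
  have key : T u v = (2⁻¹ : ℝ) • ⁅u, v⁆ := by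
    rw [← sub_eq_zero]
    refine hg.nondegenerate _ fun w ↦ ?_
    have t1 := congrArg (fun z ↦ η z w) (tors u v)
    have t2 := congrArg (fun z ↦ η z u) (tors v w)
    have t3 := congrArg (fun z ↦ η z v) (tors w u)
    have c1 := comp u v w
    have c2 := comp v w u
    have c3 := comp w u v
    have s1 := hg.symm v (T u w)
    have s2 := hg.symm w (T v u)
    have s3 := hg.symm u (T w v)
    have r1 := hg.cyclic u v w
    have r2 := hg.cyclic w u v
    simp only [map_sub, map_smul, LinearMap.sub_apply, LinearMap.smul_apply,
      smul_eq_mul] at t1 t2 t3 ⊢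
    linarith
  have := congrArg (leftTranslate I x) key
  rw [map_smul] at this
  rw [← this, hT, leftTranslate_maurerCartan]

theorem IsLeviCivita.eq_halfBracketConnection (hg : IsInvariantMetric g η)
    {D : CovariantDerivative I E (TangentSpace I : G → Type _)} (hD : IsLeviCivita g D)
    {Y : Field I G} (hY : SmoothField Y) : D Y = halfBracketConnection b Y := by
  ext1 x
  -- The difference of the connections is a tensor, so `Y` may be replaced by the left invariant
  -- field with the same value at `x`.
  have hs := smoothField_mulInvariantVectorField (maurerCartan x (Y x))
  have h1 := IsCovariantDerivativeOn.difference_apply D.isCovariantDerivativeOnUniv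
    (halfBracketConnection b).isCovariantDerivativeOnUniv (x := x) (hσ := hY.mdiff x)
  have h2 := IsCovariantDerivativeOn.difference_apply D.isCovariantDerivativeOnUniv
    (halfBracketConnection b).isCovariantDerivativeOnUniv (x := x) (hσ := hs.mdiff x)
  rw [mulInvariantVectorField_maurerCartan, h1] at h2
  rw [← sub_eq_zero, h2, sub_eq_zero]
  ext u
  rw [← mulInvariantVectorField_maurerCartan u, hD.apply_mulInvariantVectorField hg,
    halfBracketConnection_mulInvariantVectorField]

end LeviCivita

/-! ### Curvature and local symmetry -/

section Curvature

variable {E : Type*} [NormedAddCommGroup E] [NormedSpace ℝ E] [FiniteDimensional ℝ E]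
  {H : Type*} [TopologicalSpace H] {I : ModelWithCorners ℝ E H}
  {G : Type*} [TopologicalSpace G] [ChartedSpace H G] [Group G] [LieGroup I ∞ G]
  {ι : Type*} [Fintype ι] (b : Module.Basis ι ℝ (GroupLieAlgebra I G))

theorem SmoothVec.lie (b : Module.Basis ι ℝ (GroupLieAlgebra I G))
    {f h : G → GroupLieAlgebra I G} (hf : SmoothVec I f) (hh : SmoothVec I h) :
    SmoothVec I (fun x ↦ ⁅f x, h x⁆) := SmoothVec.bilin b (bracketHom I G) hf hh

theorem vecDeriv_lie {f h : G → GroupLieAlgebra I G} (hf : SmoothVec I f) (hh : SmoothVec I h)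
    (x : G) (v : TangentSpace I x) :
    vecDeriv b (fun y ↦ ⁅f y, h y⁆) x v = ⁅vecDeriv b f x v, h x⁆ + ⁅f x, vecDeriv b h x v⁆ :=
  vecDeriv_bilin (bracketHom I G) (hf.mdiffVecAt x) (hh.mdiffVecAt x) v ((hf.lie b hh).mdiffVecAt x)

theorem SmoothField.nabla_halfBracketConnection {X Y : Field I G} (hX : SmoothField X)
    (hY : SmoothField Y) : SmoothField (nabla (halfBracketConnection b) X Y) := by
  refine smoothField_of_leftForm b ?_
  rw [leftForm_nabla_halfBracketConnection]
  exact (hX.smoothVec_vecDeriv hY.smoothVec_leftForm).add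
    ((hX.smoothVec_leftForm.lie b hY.smoothVec_leftForm).smul_const _)

theorem leftForm_curvature_halfBracketConnection {X Y Z : Field I G} (hX : SmoothField X)
    (hY : SmoothField Y) (hZ : SmoothField Z) (x : G) :
    leftForm (curvature (halfBracketConnection b) X Y Z) x =
      -(4⁻¹ : ℝ) • ⁅⁅leftForm X x, leftForm Y x⁆, leftForm Z x⁆ := by
  have sX := hX.smoothVec_leftForm
  have sY := hY.smoothVec_leftForm
  have sZ := hZ.smoothVec_leftForm
  have key {V W : Field I G} (hV : SmoothField V) (hW : SmoothField W) :
      leftForm (nabla (halfBracketConnection b) V (nabla (halfBracketConnection b) W Z)) x =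
        vecDeriv b (fun y ↦ vecDeriv b (leftForm Z) y (W y)) x (V x)
        + (2⁻¹ : ℝ) • ⁅vecDeriv b (leftForm W) x (V x), leftForm Z x⁆
        + (2⁻¹ : ℝ) • (⁅leftForm W x, vecDeriv b (leftForm Z) x (V x)⁆
          + ⁅leftForm V x, vecDeriv b (leftForm Z) x (W x)⁆)
        + (4⁻¹ : ℝ) • ⁅leftForm V x, ⁅leftForm W x, leftForm Z x⁆⁆ := by
    have sB := hW.smoothVec_leftForm.lie b sZ
    rw [leftForm_nabla_halfBracketConnection, leftForm_nabla_halfBracketConnection]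
    beta_reduce
    rw [vecDeriv_add ((hW.smoothVec_vecDeriv sZ).mdiffVecAt x) ((sB.smul_const _).mdiffVecAt x)]
    have hs : vecDeriv b (fun y ↦ (2⁻¹ : ℝ) • ⁅leftForm W y, leftForm Z y⁆) x (V x) =
        (2⁻¹ : ℝ) • (⁅vecDeriv b (leftForm W) x (V x), leftForm Z x⁆
          + ⁅leftForm W x, vecDeriv b (leftForm Z) x (V x)⁆) := by
      rw [← vecDeriv_lie b hW.smoothVec_leftForm sZ]
      exact vecDeriv_map (LinearMap.lsmul ℝ _ (2⁻¹ : ℝ)) (sB.mdiffVecAt x) (V x)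
    rw [add_apply, hs, lie_add, lie_smul]
    module
  rw [curvature, leftForm_sub, leftForm_sub, key hX hY, key hY hX,
    leftForm_nabla_halfBracketConnection]
  beta_reduce
  rw [← vecDeriv_vecDeriv_sub b hX hY sZ, leftForm_mlieBracket b hX hY]
  simp only [add_lie, sub_lie, lie_lie]
  module

variable {g : BilinField I G} {η : GroupLieAlgebra I G →ₗ[ℝ] GroupLieAlgebra I G →ₗ[ℝ] ℝ}
  {D : CovariantDerivative I E (TangentSpace I : G → Type _)}

theorem IsLeviCivita.nabla_eq (hg : IsInvariantMetric g η) (hD : IsLeviCivita g D)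
    (X : Field I G) {Y : Field I G} (hY : SmoothField Y) :
    nabla D X Y = nabla (halfBracketConnection b) X Y := by
  unfold nabla
  rw [hD.eq_halfBracketConnection b hg hY]

theorem IsLeviCivita.curvature04_eq (b : Module.Basis ι ℝ (GroupLieAlgebra I G))
    (hg : IsInvariantMetric g η) (hD : IsLeviCivita g D)
    {X Y Z : Field I G} (hX : SmoothField X) (hY : SmoothField Y) (hZ : SmoothField Z)
    (U : Field I G) : curvature04 g D X Y Z U =
      fun x ↦ η (-(4⁻¹ : ℝ) • ⁅⁅leftForm X x, leftForm Y x⁆, leftForm Z x⁆) (leftForm U x) := by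
  have : curvature D X Y Z = curvature (halfBracketConnection b) X Y Z := by
    unfold curvature
    rw [hD.nabla_eq b hg _ hZ, hD.nabla_eq b hg _ hZ, hD.nabla_eq b hg _ hZ,
      hD.nabla_eq b hg _ (hY.nabla_halfBracketConnection b hZ),
      hD.nabla_eq b hg _ (hX.nabla_halfBracketConnection b hZ)]
  rw [curvature04, this, hg.pairing_eq]
  ext x
  rw [leftForm_curvature_halfBracketConnection b hX hY hZ]

theorem IsLeviCivita.isLocallySymmetric (b : Module.Basis ι ℝ (GroupLieAlgebra I G))
    (hg : IsInvariantMetric g η) (hD : IsLeviCivita g D) :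
    IsLocallySymmetric g D := by
  intro V X Y Z U hV hX hY hZ hU
  have sX := hX.smoothVec_leftForm
  have sY := hY.smoothVec_leftForm
  have sZ := hZ.smoothVec_leftForm
  have sXY := sX.lie b sY
  have sXYZ := sXY.lie b sZ
  ext x
  simp only [nablaCurvature04, hD.nabla_eq b hg V hX, hD.nabla_eq b hg V hY,
    hD.nabla_eq b hg V hZ, hD.nabla_eq b hg V hU, Pi.sub_apply, Pi.zero_apply]
  rw [hD.curvature04_eq b hg hX hY hZ, hD.curvature04_eq b hg hX hY hZ,
    hD.curvature04_eq b hg (hV.nabla_halfBracketConnection b hX) hY hZ,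
    hD.curvature04_eq b hg hX (hV.nabla_halfBracketConnection b hY) hZ,
    hD.curvature04_eq b hg hX hY (hV.nabla_halfBracketConnection b hZ), derivAlong_apply,
    mvfderiv_bilin (b := b) η ((sXYZ.smul_const _).mdiffVecAt x)
      (hU.smoothVec_leftForm.mdiffVecAt x)]
  have hs : vecDeriv b (fun y ↦ -(4⁻¹ : ℝ) • ⁅⁅leftForm X y, leftForm Y y⁆, leftForm Z y⁆) x (V x) =
      -(4⁻¹ : ℝ) • (⁅⁅vecDeriv b (leftForm X) x (V x), leftForm Y x⁆
          + ⁅leftForm X x, vecDeriv b (leftForm Y) x (V x)⁆, leftForm Z x⁆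
        + ⁅⁅leftForm X x, leftForm Y x⁆, vecDeriv b (leftForm Z) x (V x)⁆) := by
    rw [← vecDeriv_lie b sX sY, ← vecDeriv_lie b sXY sZ]
    exact vecDeriv_map (LinearMap.lsmul ℝ _ (-4⁻¹ : ℝ)) (sXYZ.mdiffVecAt x) (V x)
  rw [hs]
  simp only [leftForm_nabla_halfBracketConnection]
  generalize vecDeriv b (leftForm X) x (V x) = dX
  generalize vecDeriv b (leftForm Y) x (V x) = dY
  generalize vecDeriv b (leftForm Z) x (V x) = dZ
  generalize vecDeriv b (leftForm U) x (V x) = dU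
  generalize leftForm X x = p, leftForm Y x = q, leftForm Z x = r, leftForm U x = s,
    leftForm V x = v
  -- The remaining terms are those of the `ad`-invariance of `η` along `⁅v, ·⁆`, for the curvature
  -- `⁅⁅p, q⁆, r⁆` expanded by the Jacobi identity.
  have jac : ⁅v, ⁅⁅p, q⁆, r⁆⁆ = ⁅⁅⁅v, p⁆, q⁆, r⁆ + ⁅⁅p, ⁅v, q⁆⁆, r⁆ + ⁅⁅p, q⁆, ⁅v, r⁆⁆ := by
    rw [leibniz_lie v ⁅p, q⁆ r, leibniz_lie v p q, add_lie]
  have had := hg.ad v ⁅⁅p, q⁆, r⁆ s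
  rw [jac] at had
  simp only [add_lie, lie_add, smul_lie, lie_smul, map_add, map_smul, LinearMap.add_apply,
    LinearMap.smul_apply, smul_eq_mul] at had ⊢
  linear_combination (8⁻¹ : ℝ) * had

end Curvature

/-! ### The quasi-Kähler property -/

section QuasiKahler

variable {E : Type*} [NormedAddCommGroup E] [NormedSpace ℝ E] [FiniteDimensional ℝ E]
  {H : Type*} [TopologicalSpace H] {I : ModelWithCorners ℝ E H}
  {G : Type*} [TopologicalSpace G] [ChartedSpace H G] [Group G] [LieGroup I ∞ G]
  {ι : Type*} [Fintype ι]
  {g : BilinField I G} {η : GroupLieAlgebra I G →ₗ[ℝ] GroupLieAlgebra I G →ₗ[ℝ] ℝ}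
  {J : EndField I G} {j : GroupLieAlgebra I G →ₗ[ℝ] GroupLieAlgebra I G}

theorem isAlmostComplexNorden_of_leftInvariant (b : Module.Basis ι ℝ (GroupLieAlgebra I G))
    (hg : IsInvariantMetric g η)
    (hJ : ∀ (x : G) (u : TangentSpace I x), maurerCartan x (J x u) = j (maurerCartan x u))
    (hj : ∀ u : GroupLieAlgebra I G, j (j u) = -u)
    (hjη : ∀ u v : GroupLieAlgebra I G, η (j u) (j v) = -η u v) :
    IsAlmostComplexNorden J g where
  smooth_J X hX := smoothField_of_leftForm b <| by
    have : leftForm (applyEnd J X) = fun x ↦ j (leftForm X x) := funext fun x ↦ hJ x _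
    rw [this]
    exact hX.smoothVec_leftForm.map j
  smooth_g X Y hX hY := by
    rw [hg.pairing_eq]
    exact SmoothVec.bilin b η hX.smoothVec_leftForm hY.smoothVec_leftForm LinearMap.id
  symm x u v := by rw [hg.apply, hg.apply, hg.symm]
  nondegenerate x u h := by
    rw [← leftTranslate_maurerCartan u, hg.nondegenerate (maurerCartan x u), map_zero]
    intro v
    have := h (leftTranslate I x v)
    rwa [hg.apply, maurerCartan_leftTranslate] at this
  J_sq x u := by
    rw [← leftTranslate_maurerCartan (J x (J x u)), hJ, hJ, hj, map_neg, leftTranslate_maurerCartan]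
  anti x u v := by rw [hg.apply, hg.apply, hJ, hJ, hjη]

theorem isW3_of_leftInvariant (b : Module.Basis ι ℝ (GroupLieAlgebra I G))
    (hg : IsInvariantMetric g η)
    (hJ : ∀ (x : G) (u : TangentSpace I x), maurerCartan x (J x u) = j (maurerCartan x u))
    (hj : ∀ u : GroupLieAlgebra I G, j (j u) = -u)
    (hjη : ∀ u v : GroupLieAlgebra I G, η (j u) (j v) = -η u v)
    {D : CovariantDerivative I E (TangentSpace I : G → Type _)} (hD : IsLeviCivita g D) :
    IsW3 J g D where
  norden := isAlmostComplexNorden_of_leftInvariant b hg hJ hj hjη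
  cyclic := by
    have hN := isAlmostComplexNorden_of_leftInvariant b hg hJ hj hjη
    have hJ' (X : Field I G) : leftForm (applyEnd J X) = fun x ↦ j (leftForm X x) :=
      funext fun x ↦ hJ x _
    have hjη' (u v : GroupLieAlgebra I G) : η (j u) v = η u (j v) := by
      have := hjη u (j v)
      rw [hj, map_neg] at this
      exact neg_injective this
    -- `F(X, Y, Z) = ½ (φ(X, jY, Z) - φ(X, Y, jZ))` with `φ(u, v, w) = η(⁅u, v⁆, w)`.
    have key {X Y Z : Field I G} (hY : SmoothField Y) (x : G) : tensorF J g D X Y Z x =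
        2⁻¹ * (η ⁅leftForm X x, j (leftForm Y x)⁆ (leftForm Z x)
          - η ⁅leftForm X x, leftForm Y x⁆ (j (leftForm Z x))) := by
      rw [tensorF, hg.pairing_eq, hD.nabla_eq b hg _ (hN.smooth_J Y hY), hD.nabla_eq b hg _ hY]
      beta_reduce
      rw [leftForm_sub, hJ', leftForm_nabla_halfBracketConnection,
        leftForm_nabla_halfBracketConnection, hJ']
      simp only [vecDeriv_map j (hY.smoothVec_leftForm.mdiffVecAt x), map_add, map_smul, map_sub,
        LinearMap.add_apply, LinearMap.sub_apply, LinearMap.smul_apply, smul_eq_mul, hjη']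
      ring
    intro X Y Z hX hY hZ
    ext x
    simp only [Pi.add_apply, Pi.zero_apply, key hX, key hY, key hZ]
    have c1 := hg.cyclic (leftForm X x) (leftForm Y x) (j (leftForm Z x))
    have c2 := hg.cyclic (leftForm Y x) (leftForm Z x) (j (leftForm X x))
    have c3 := hg.cyclic (leftForm Z x) (leftForm X x) (j (leftForm Y x))
    linear_combination 2⁻¹ * (c1 + c2 + c3)

end QuasiKahler

/-! ### The tensors determined by a basis of the Lie algebra -/

section Basis

variable {E : Type*} [NormedAddCommGroup E] [NormedSpace ℝ E]
  {H : Type*} [TopologicalSpace H] {I : ModelWithCorners ℝ E H}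
  {G : Type*} [TopologicalSpace G] [ChartedSpace H G] [Group G]
  {n : ℕ} {b : Module.Basis (Fin n ⊕ Fin n) ℝ (GroupLieAlgebra I G)}
  {J : EndField I G} {g : BilinField I G}

/-- The value of `g` at the identity, as a bilinear form on the Lie algebra. -/
def formAtOne (g : BilinField I G) :
    GroupLieAlgebra I G →ₗ[ℝ] GroupLieAlgebra I G →ₗ[ℝ] ℝ :=
  LinearMap.mk₂ ℝ (fun u v ↦ g 1 u v) (by simp) (by simp) (by simp) (by simp)

theorem IsAlmostNordenOfBasis.apply_eq (h : IsAlmostNordenOfBasis b J g) (x : G)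
    (u v : GroupLieAlgebra I G) :
    g x (leftTranslate I x u) (leftTranslate I x v) = formAtOne g u v := by
  let β : GroupLieAlgebra I G →ₗ[ℝ] GroupLieAlgebra I G →ₗ[ℝ] ℝ :=
    LinearMap.mk₂ ℝ (fun u v ↦ g x (leftTranslate I x u) (leftTranslate I x v))
      (by simp) (by simp) (by simp) (by simp)
  suffices β = formAtOne g from congrArg (fun β ↦ β u v) this
  refine b.ext fun i ↦ b.ext fun k ↦ ?_
  change g x (mulInvariantVectorField (b i) x) (mulInvariantVectorField (b k) x) =
    g 1 (b i) (b k)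
  have e (k) := mulInvariantVectorField_one (b k)
  by_cases hik : i = k
  · subst hik
    rcases i with i | i
    · have := h.g_inl i 1
      rw [e] at this
      rw [h.g_inl, this]
    · have := h.g_inr i 1
      rw [e] at this
      rw [h.g_inr, this]
  · have := h.g_ne i k hik 1
    rw [e, e] at this
    rw [h.g_ne i k hik, this]

theorem IsAlmostNordenOfBasis.sq_one (h : IsAlmostNordenOfBasis b J g)
    (u : GroupLieAlgebra I G) : J 1 (J 1 u) = -u := by
  have e (k) := mulInvariantVectorField_one (b k)
  have hl (i) := h.J_inl i 1
  have hr (i) := h.J_inr i 1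
  simp only [e] at hl hr
  suffices (J 1).toLinearMap ∘ₗ (J 1).toLinearMap =
      (-LinearMap.id : GroupLieAlgebra I G →ₗ[ℝ] GroupLieAlgebra I G) from
    congrArg (fun A : GroupLieAlgebra I G →ₗ[ℝ] GroupLieAlgebra I G ↦ A u) this
  refine b.ext fun i ↦ ?_
  change J 1 (J 1 (b i)) = -b i
  rcases i with i | i
  · rw [hl, hr]
  · rw [hr, map_neg, hl]

theorem IsAlmostNordenOfBasis.anti_one (h : IsAlmostNordenOfBasis b J g)
    (u v : GroupLieAlgebra I G) :
    formAtOne g (J 1 u) (J 1 v) = -formAtOne g u v := by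
  have e (k) := mulInvariantVectorField_one (b k)
  have hl (i) := h.J_inl i 1
  have hr (i) := h.J_inr i 1
  have gl (i) := h.g_inl i 1
  have gr (i) := h.g_inr i 1
  have gn (i k) (hik : i ≠ k) := h.g_ne i k hik 1
  simp only [e] at hl hr gl gr gn
  suffices (formAtOne g).compl₁₂ (J 1).toLinearMap (J 1).toLinearMap = -formAtOne g from
    congrArg (fun β ↦ β u v) this
  refine b.ext fun i ↦ b.ext fun k ↦ ?_
  change g 1 (J 1 (b i)) (J 1 (b k)) = -g 1 (b i) (b k)
  rcases i with i | i <;> rcases k with k | k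
  · rw [hl, hl]
    by_cases hik : i = k
    · rw [hik, gl, gr]
    · rw [gn _ _ (by simpa using hik), gn _ _ (by simpa using hik), neg_zero]
  · rw [hl, hr, map_neg]
    rw [gn _ _ (by simp), gn _ _ (by simp)]
  · rw [hl, hr, map_neg, neg_apply]
    rw [gn _ _ (by simp), gn _ _ (by simp)]
  · rw [hr, hr, map_neg, map_neg, neg_apply, neg_neg]
    by_cases hik : i = k
    · rw [hik, gl, gr, neg_neg]
    · rw [gn _ _ (by simpa using hik), gn _ _ (by simpa using hik), neg_zero]

variable [LieGroup I ∞ G]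

theorem IsAlmostNordenOfBasis.isInvariantMetric (h : IsAlmostNordenOfBasis b J g)
    (hg : IsKillingMetric g) : IsInvariantMetric g (formAtOne g) := by
  have hne {i k} (hik : i ≠ k) : formAtOne g (b i) (b k) = 0 := by
    rw [← h.apply_eq 1]; exact h.g_ne i k hik 1
  have hnz (i) : formAtOne g (b i) (b i) ≠ 0 := by
    rw [← h.apply_eq 1]
    rcases i with i | i
    · exact (h.g_inl i 1).trans_ne one_ne_zero
    · exact (h.g_inr i 1).trans_ne (neg_ne_zero.2 one_ne_zero)
  refine ⟨fun x u v ↦ ?_, fun u v ↦ ?_, fun u hu ↦ b.ext_elem fun i ↦ ?_, hg⟩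
  · rw [← h.apply_eq x, leftTranslate_maurerCartan, leftTranslate_maurerCartan]
  · suffices formAtOne g = (formAtOne g).flip from congrArg (fun β ↦ β u v) this
    refine b.ext fun i ↦ b.ext fun k ↦ ?_
    rw [LinearMap.flip_apply]
    by_cases hik : i = k
    · rw [hik]
    · rw [hne hik, hne (Ne.symm hik)]
  · have := hu (b i)
    rw [← b.sum_repr u, map_sum, LinearMap.sum_apply, Finset.sum_eq_single i] at this
    · simpa [hnz i] using this
    · intro k _ hk
      simp [hne hk]
    · simp

theorem IsAlmostNordenOfBasis.maurerCartan_apply (h : IsAlmostNordenOfBasis b J g) (x : G)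
    (u : TangentSpace I x) : maurerCartan x (J x u) = J 1 (maurerCartan x u) := by
  let A : GroupLieAlgebra I G →ₗ[ℝ] GroupLieAlgebra I G :=
    ((maurerCartan x).comp ((J x).comp (leftTranslate I x))).toLinearMap
  suffices A = (J 1).toLinearMap by
    have := congrArg (fun A : GroupLieAlgebra I G →ₗ[ℝ] GroupLieAlgebra I G ↦
      A (maurerCartan x u)) this
    rw [← leftTranslate_maurerCartan u, maurerCartan_leftTranslate]
    exact this
  have e (k) := mulInvariantVectorField_one (b k)
  refine b.ext fun i ↦ ?_
  change maurerCartan x (J x (mulInvariantVectorField (b i) x)) = J 1 (b i)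
  rcases i with i | i
  · have := h.J_inl i 1
    rw [e, e] at this
    rw [this, h.J_inl, maurerCartan_mulInvariantVectorField]
  · have := h.J_inr i 1
    rw [e, e] at this
    rw [this, h.J_inr, map_neg, maurerCartan_mulInvariantVectorField]

end Basis

end Norden

end

theorem theorem2p1
    {E : Type*} [NormedAddCommGroup E] [NormedSpace ℝ E] [FiniteDimensional ℝ E]
    {H : Type*} [TopologicalSpace H] (I : ModelWithCorners ℝ E H) [I.Boundaryless]
    {G : Type*} [TopologicalSpace G] [ChartedSpace H G] [Group G] [LieGroup I ∞ G]
    {n : ℕ} (b : Module.Basis (Fin n ⊕ Fin n) ℝ (GroupLieAlgebra I G))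
    (J : Norden.EndField I G) (g : Norden.BilinField I G)
    (hJg : Norden.IsAlmostNordenOfBasis b J g) (hg : Norden.IsKillingMetric g) :
    (∃ D : CovariantDerivative I E (TangentSpace I : G → Type _), Norden.IsLeviCivita g D) ∧
    ∀ D : CovariantDerivative I E (TangentSpace I : G → Type _), Norden.IsLeviCivita g D →
      Norden.IsW3 J g D ∧ Norden.IsLocallySymmetric g D := by
  have hη := hJg.isInvariantMetric hg
  exact ⟨⟨Norden.halfBracketConnection b, hη.isLeviCivita b⟩, fun D hD ↦
    ⟨Norden.isW3_of_leftInvariant (j := (J 1).toLinearMap) b hη hJg.maurerCartan_apply hJg.sq_one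
      hJg.anti_one hD, hD.isLocallySymmetric b hη⟩⟩
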